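/- Let $d\in\mathbb N$ and let $\|\cdot\|$ be the Euclidean norm on $\mathbb R^d$. Let $P, P_1, P_2, \dots$ be probability measures on $\mathbb R^d$ with log-concave Lebesgue densities $f, f_1, f_2, \dots$; that is, $f=\exp\circ\varphi$ and $f_n=\exp\circ\varphi_n$ everywhere on $\mathbb R^d$ for some concave functions $\varphi,\varphi_n:\mathbb R^d\to[-\infty,\infty)$, where $\exp(-\infty)=0$. Suppose that $P_n\to P$ weakly as $n\to\infty$. Then: (i) $f_n\to f$ uniformly on every closed set $S\subset\mathbb R^d$ such that $f$ is continuous (as a function on $\mathbb R^d$) at every point of $S$. In particular, $f_n(x)\to f(x)$ for Lebesgue-almost every $x\in\mathbb R^d$. (ii) Let $A:\mathbb R^d\to\mathbb R$ be sublinear, i.e. $A(x+y)\le A(x)+A(y)$ and $A(rx)=rA(x)$ for all $x,y\in\mathbb R^d$ and all $r\ge 0$. If $f(x)\exp(A(x))\to 0$ as $\|x\|\to\infty$, then $$\int_{\mathbb R^d} \exp(A(x))\,f(x)\,dx<\infty \qquad\text{and}\qquad \lim_{n\to\infty}\int_{\mathbb R^d}\exp(A(x))\,|f_n(x)-f(x)|\,dx=0,$$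 where the integrals are taken in $[0,\infty]$. In particular, $P_n\to P$ in total variation: $\int_{\mathbb R^d}|f_n(x)-f(x)|\,dx\to 0$, and $\sup_B|P_n(B)-P(B)|\to0$, the supremum being over all Borel sets $B\subset\mathbb R^d$. -/

import Mathlib

open MeasureTheory Filter Topology

/-- An extended-valued function `φ : E → [-∞, ∞)` (the value `+∞` is excluded) that is concave.
In `EReal` one has `0 * ⊥ = 0` and `⊥ + a = ⊥`, the usual conventions for such functions. -/
structure IsExtConcave {E : Type*} [AddCommGroup E] [Module ℝ E] (φ : E → EReal) : Prop where
  lt_top : ∀ x, φ x < ⊤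
  concave : ∀ (x y : E) (t : ℝ), 0 ≤ t → t ≤ 1 →
    ((1 - t : ℝ) : EReal) * φ x + (t : EReal) * φ y ≤ φ ((1 - t) • x + t • y)

/-- `f = exp ∘ φ` for some concave `φ : E → [-∞, ∞)`, where `exp (-∞) = 0`.
(`EReal.exp` takes values in `[0, ∞]`; it is finite here because `φ < ⊤`.) -/
def IsLogConcave {E : Type*} [AddCommGroup E] [Module ℝ E] (f : E → ℝ) : Prop :=
  ∃ φ : E → EReal, IsExtConcave φ ∧ ∀ x, f x = (EReal.exp (φ x)).toReal

/-- `f` is a log-concave Lebesgue density of the measure `P` on `ℝ^d`. -/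
structure IsLogConcaveDensity {d : ℕ} (P : Measure (EuclideanSpace ℝ (Fin d)))
    (f : EuclideanSpace ℝ (Fin d) → ℝ) : Prop where
  logConcave : IsLogConcave f
  density : P = volume.withDensity (fun x => ENNReal.ofReal (f x))

/-- Sublinear functions: subadditive and positively homogeneous (including the factor `0`). -/
structure IsSublinear {E : Type*} [AddCommGroup E] [Module ℝ E] (A : E → ℝ) : Prop where
  add_le : ∀ x y, A (x + y) ≤ A x + A y
  smul_eq : ∀ (r : ℝ) (x : E), 0 ≤ r → A (r • x) = r * A x

/-- The total variation distance of two probability measures, `sup_B |μ(B) - ν(B)|` over all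
measurable sets `B`. -/
noncomputable def tvDistance {E : Type*} [MeasurableSpace E] (μ ν : ProbabilityMeasure E) : ℝ :=
  ⨆ B : {B : Set E // MeasurableSet B}, |(μ : Measure E).real B - (ν : Measure E).real B|

section

open Metric Set

section LogConcave

variable {E : Type*} [AddCommGroup E] [Module ℝ E] {f : E → ℝ}

lemma IsLogConcave.nonneg (hf : IsLogConcave f) (x : E) : 0 ≤ f x := by
  obtain ⟨φ, -, h⟩ := hf
  rw [h]
  exact ENNReal.toReal_nonneg

lemma IsLogConcave.rpow_mul_rpow_le (hf : IsLogConcave f) (x y : E) {t : ℝ} (h0 : 0 < t)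
    (h1 : t < 1) : f x ^ (1 - t) * f y ^ t ≤ f ((1 - t) • x + t • y) := by
  by_cases hx : f x = 0
  · rw [hx, Real.zero_rpow (by linarith), zero_mul]
    exact hf.nonneg _
  by_cases hy : f y = 0
  · rw [hy, Real.zero_rpow (by linarith), mul_zero]
    exact hf.nonneg _
  obtain ⟨φ, hφ, h⟩ := hf
  have hbot : ∀ z, f z ≠ 0 → ∃ r : ℝ, φ z = r ∧ f z = Real.exp r := by
    intro z hz
    have hb : φ z ≠ ⊥ := by
      intro hb
      exact hz (by simp [h, hb])
    refine ⟨(φ z).toReal, (EReal.coe_toReal (hφ.lt_top z).ne hb).symm, ?_⟩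
    rw [h]
    conv_lhs => rw [← EReal.coe_toReal (hφ.lt_top z).ne hb]
    rw [EReal.exp_coe, ENNReal.toReal_ofReal (Real.exp_pos _).le]
  obtain ⟨a, ha, hfa⟩ := hbot x hx
  obtain ⟨b, hb, hfb⟩ := hbot y hy
  have hc := hφ.concave x y t h0.le h1.le
  rw [ha, hb, ← EReal.coe_mul, ← EReal.coe_mul, ← EReal.coe_add] at hc
  have hexp := ENNReal.toReal_mono (EReal.exp_lt_top_iff.2 (hφ.lt_top _)).ne
    (EReal.exp_monotone hc)
  rw [← h, EReal.exp_coe, ENNReal.toReal_ofReal (Real.exp_pos _).le] at hexp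
  rw [hfa, hfb, ← Real.exp_mul, ← Real.exp_mul, ← Real.exp_add]
  convert hexp using 2
  ring

lemma IsLogConcave.rpow_mul_rpow_le_of_le (hf : IsLogConcave f) {x y : E} {a b t : ℝ}
    (h0 : 0 < t) (h1 : t < 1) (ha : 0 ≤ a) (hb : 0 ≤ b) (hax : a ≤ f x) (hby : b ≤ f y) :
    a ^ (1 - t) * b ^ t ≤ f ((1 - t) • x + t • y) := by
  refine le_trans ?_ (hf.rpow_mul_rpow_le x y h0 h1)
  have : 0 ≤ 1 - t := by linarith
  gcongr
  exact Real.rpow_nonneg (hf.nonneg x) _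

lemma IsLogConcave.convex_ge (hf : IsLogConcave f) (c : ℝ) : Convex ℝ {x | c ≤ f x} := by
  rcases le_or_gt c 0 with hc | hc
  · convert convex_univ
    exact eq_univ_of_forall fun x => hc.trans (hf.nonneg x)
  rw [convex_iff_forall_pos]
  intro x hx y hy a b ha hb hab
  have h := hf.rpow_mul_rpow_le_of_le (t := b) hb (by linarith) hc.le hc.le hx hy
  rw [← Real.rpow_add hc, sub_add_cancel, Real.rpow_one, ← hab, add_sub_cancel_right] at h
  exact h

lemma IsLogConcave.concaveOn_log (hf : IsLogConcave f) :
    ConcaveOn ℝ {x | 0 < f x} (fun x => Real.log (f x)) := by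
  have key : ∀ x y : E, 0 < f x → 0 < f y → ∀ a b : ℝ, 0 < a → 0 < b → a + b = 1 →
      0 < f (a • x + b • y) ∧
        a * Real.log (f x) + b * Real.log (f y) ≤ Real.log (f (a • x + b • y)) := by
    intro x y hx hy a b ha hb hab
    have h := hf.rpow_mul_rpow_le x y hb (by linarith)
    obtain rfl : a = 1 - b := by linarith
    have hpos : 0 < f x ^ (1 - b) * f y ^ b := by positivity
    refine ⟨hpos.trans_le h, ?_⟩
    rw [← Real.log_rpow hx, ← Real.log_rpow hy, ← Real.log_mul (by positivity) (by positivity)]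
    exact Real.log_le_log hpos h
  rw [concaveOn_iff_forall_pos, convex_iff_forall_pos]
  exact ⟨fun x hx y hy a b ha hb hab => (key x y hx hy a b ha hb hab).1,
    fun x hx y hy a b ha hb hab => (key x y hx hy a b ha hb hab).2⟩

end LogConcave

section Normed

variable {E : Type*} [NormedAddCommGroup E] [NormedSpace ℝ E]

/-- A log-concave function that is bounded below on a ball is bounded below on the balls obtained
by contracting this ball towards another point. -/
lemma IsLogConcave.rpow_mul_rpow_le_on_ball {f : E → ℝ} (hf : IsLogConcave f) {w y : E}
    {s b c t : ℝ} (hb : 0 ≤ b) (hc : 0 ≤ c) (hw : ∀ z ∈ ball w s, b ≤ f z) (hy : c ≤ f y)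
    (h0 : 0 < t) (h1 : t < 1) :
    ∀ p ∈ ball ((1 - t) • y + t • w) (t * s), c ^ (1 - t) * b ^ t ≤ f p := by
  intro p hp
  have hz : w + t⁻¹ • (p - ((1 - t) • y + t • w)) ∈ ball w s := by
    rw [mem_ball, dist_eq_norm] at hp ⊢
    rw [add_sub_cancel_left, norm_smul, Real.norm_eq_abs, abs_of_pos (inv_pos.2 h0),
      inv_mul_lt_iff₀ h0]
    exact hp
  have h := hf.rpow_mul_rpow_le_of_le h0 h1 hc hb hy (hw _ hz)
  convert h using 2
  rw [smul_add, smul_inv_smul₀ h0.ne']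
  abel

variable [FiniteDimensional ℝ E]

lemma Convex.nonempty_interior_of_closure {C : Set E} (hC : Convex ℝ C)
    (h : (interior (closure C)).Nonempty) : (interior C).Nonempty := by
  rw [hC.interior_nonempty_iff_affineSpan_eq_top, eq_top_iff]
  rw [hC.closure.interior_nonempty_iff_affineSpan_eq_top] at h
  rw [← h, affineSpan_le]
  exact closure_minimal (subset_affineSpan _ _) (affineSpan ℝ C).closed_of_finiteDimensional

/-- A convex set that is `ε`-dense in a ball of radius `ρ + ε` contains the ball of radius `ρ`. -/
lemma Convex.ball_subset_of_dense {C : Set E} (hC : Convex ℝ C) {x₀ : E} {ρ ε : ℝ} (hε : 0 < ε)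
    (h : ∀ y ∈ ball x₀ (ρ + ε), ∃ z ∈ C, dist y z ≤ ε) : ball x₀ ρ ⊆ C := by
  have hcl : ball x₀ ρ ⊆ closure C := by
    intro y hy
    by_contra hyC
    obtain ⟨g, u, hgC, hgy⟩ := geometric_hahn_banach_closed_point hC.closure isClosed_closure hyC
    rw [mem_ball] at hy
    have hρ : 0 < ρ := dist_nonneg.trans_lt hy
    obtain ⟨z₀, hz₀, -⟩ := h x₀ (mem_ball_self (by linarith))
    have hg : 0 < ‖g‖ := by
      rw [norm_pos_iff]
      rintro rfl
      have := hgC z₀ (subset_closure hz₀)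
      simp only [zero_apply] at this hgy
      linarith
    -- a vector of norm less than `ρ + ε - dist y x₀` on which `g` exceeds `ε * ‖g‖`
    obtain ⟨v, hv, hgv⟩ : ∃ v : E, ‖v‖ < ρ + ε - dist y x₀ ∧ ε * ‖g‖ ≤ g v := by
      set η := ρ + ε - dist y x₀ with hη
      have hηε : ε < η := by linarith
      have hη0 : 0 < η := hε.trans hηε
      obtain ⟨v, hv1, hv2⟩ := g.exists_lt_apply_of_lt_opNorm
        (r := ε / η * ‖g‖) (by
          have : ε / η < 1 := by rw [div_lt_one hη0]; exact hηε
          nlinarith)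
      have hlt : ε * ‖g‖ < η * ‖g v‖ := by
        have := mul_lt_mul_of_pos_left hv2 hη0
        calc ε * ‖g‖ = η * (ε / η * ‖g‖) := by field_simp
          _ < _ := this
      have hnorm : ‖η • v‖ < η := by
        rw [norm_smul, Real.norm_eq_abs, abs_of_pos hη0]
        nlinarith
      rw [Real.norm_eq_abs] at hlt
      rcases abs_cases (g v) with ⟨he, -⟩ | ⟨he, -⟩
      · exact ⟨η • v, hnorm, by rw [map_smul, smul_eq_mul]; rw [he] at hlt; exact hlt.le⟩
      · refine ⟨-(η • v), by rwa [norm_neg], ?_⟩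
        rw [map_neg, map_smul, smul_eq_mul]
        rw [he] at hlt
        linarith
    obtain ⟨z, hz, hyz⟩ := h (y + v) (by
      rw [mem_ball]
      calc dist (y + v) x₀ ≤ dist (y + v) y + dist y x₀ := dist_triangle _ _ _
        _ = ‖v‖ + dist y x₀ := by rw [dist_eq_norm, add_sub_cancel_left]
        _ < ρ + ε := by linarith)
    have h1 : g (y + v) - g z ≤ ‖g‖ * ε := by
      rw [← map_sub]
      refine (le_abs_self _).trans ((g.le_opNorm _).trans ?_)
      rw [← dist_eq_norm]
      gcongr
    have h2 := hgC z (subset_closure hz)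
    rw [map_add] at h1
    linarith
  rcases (ball x₀ ρ).eq_empty_or_nonempty with he | hne
  · rw [he]; exact empty_subset _
  have hint : ball x₀ ρ ⊆ interior (closure C) := interior_maximal hcl isOpen_ball
  rw [hC.interior_closure_eq_interior_of_nonempty_interior
    (hC.nonempty_interior_of_closure (hne.mono hint))] at hint
  exact hint.trans interior_subset

lemma IsLogConcave.continuousAt {f : E → ℝ} (hf : IsLogConcave f) {x : E}
    (hx : x ∈ interior {x | 0 < f x}) : ContinuousAt f x := by
  have hlog : ContinuousAt (fun x => Real.log (f x)) x :=
    ((hf.concaveOn_log.subset interior_subset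
      hf.concaveOn_log.1.interior).continuousOn isOpen_interior).continuousAt
      (isOpen_interior.mem_nhds hx)
  refine (Real.continuous_exp.continuousAt.comp hlog).congr ?_
  filter_upwards [isOpen_interior.mem_nhds hx] with y hy
  have hpos : 0 < f y := interior_subset (s := {x | 0 < f x}) hy
  exact Real.exp_log hpos

variable [MeasurableSpace E] [BorelSpace E] {μ : Measure E} [μ.IsAddHaarMeasure]

lemma IsLogConcave.ae_continuousAt {f : E → ℝ} (hf : IsLogConcave f) :
    ∀ᵐ x ∂μ, ContinuousAt f x := by
  have h0 := hf.concaveOn_log.1.addHaar_frontier μ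
  filter_upwards [measure_eq_zero_iff_ae_notMem.1 h0] with x hx
  by_cases hi : x ∈ interior {x | 0 < f x}
  · exact hf.continuousAt hi
  have hc : x ∉ closure {x | 0 < f x} := fun hc => hx ⟨hc, hi⟩
  refine (continuousAt_const (y := (0 : ℝ))).congr ?_
  filter_upwards [isClosed_closure.isOpen_compl.mem_nhds hc] with y hy
  exact le_antisymm (hf.nonneg y) (not_lt.1 fun h => hy (subset_closure h))

lemma IsLogConcave.aemeasurable {f : E → ℝ} (hf : IsLogConcave f) : AEMeasurable f μ := by
  have : NullMeasurable f μ := by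
    refine @measurable_of_Ici ℝ (NullMeasurableSpace E μ) _ _ _ _ _ _ _ _ fun c => ?_
    exact (hf.convex_ge c).nullMeasurableSet μ
  exact this.aemeasurable

/-- Eventual statements that hold locally uniformly hold uniformly on compact sets. -/
lemma IsCompact.eventually_forall_of_nhds {X ι : Type*} [TopologicalSpace X] {K : Set X}
    (hK : IsCompact K) {l : Filter ι} {p : ι → X → Prop}
    (h : ∀ x ∈ K, ∃ U ∈ 𝓝 x, ∀ᶠ n in l, ∀ y ∈ U, p n y) : ∀ᶠ n in l, ∀ y ∈ K, p n y := by
  choose! U hU hp using h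
  obtain ⟨t, ht, hKt⟩ := hK.elim_nhds_subcover U hU
  have : ∀ᶠ n in l, ∀ x ∈ t, ∀ y ∈ U x, p n y := t.eventually_all.2 fun x hx => hp x (ht x hx)
  filter_upwards [this] with n hn y hy
  obtain ⟨x, hx, hyx⟩ := mem_iUnion₂.1 (hKt hy)
  exact hn x hx y hyx

end Normed

section Density

variable {d : ℕ} {Q : Measure (EuclideanSpace ℝ (Fin d))} {f : EuclideanSpace ℝ (Fin d) → ℝ}
  {B : Set (EuclideanSpace ℝ (Fin d))} {c : ℝ}

lemma IsLogConcaveDensity.apply (hf : IsLogConcaveDensity Q f) (hB : MeasurableSet B) :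
    Q B = ∫⁻ x in B, ENNReal.ofReal (f x) := by
  rw [hf.density, withDensity_apply _ hB]

lemma IsLogConcaveDensity.mul_volume_le (hf : IsLogConcaveDensity Q f) (hB : MeasurableSet B)
    (h : ∀ x ∈ B, c ≤ f x) : ENNReal.ofReal c * volume B ≤ Q B := by
  rw [hf.apply hB, ← setLIntegral_const]
  exact setLIntegral_mono' hB fun x hx => ENNReal.ofReal_le_ofReal (h x hx)

lemma IsLogConcaveDensity.le_mul_volume (hf : IsLogConcaveDensity Q f) (hB : MeasurableSet B)
    (h : ∀ x ∈ B, f x ≤ c) : Q B ≤ ENNReal.ofReal c * volume B := by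
  rw [hf.apply hB, ← setLIntegral_const]
  exact setLIntegral_mono' hB fun x hx => ENNReal.ofReal_le_ofReal (h x hx)

lemma IsLogConcaveDensity.exists_ball [IsProbabilityMeasure Q] (hf : IsLogConcaveDensity Q f) :
    ∃ w : EuclideanSpace ℝ (Fin d), ∃ s > 0, ∃ b > 0, ∀ z ∈ ball w s, b ≤ f z := by
  have hconv := hf.logConcave.concaveOn_log.1
  have hne : (interior {x | 0 < f x}).Nonempty := by
    rw [nonempty_iff_ne_empty]
    intro he
    have h0 : volume {x | 0 < f x} = 0 := by
      refine measure_mono_null ?_ (hconv.addHaar_frontier volume)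
      rw [frontier, he, sdiff_empty]
      exact subset_closure
    have h1 : Q univ = 0 := by
      rw [hf.apply MeasurableSet.univ, setLIntegral_univ]
      have hz : (fun x => ENNReal.ofReal (f x)) =ᵐ[volume] 0 := by
        filter_upwards [measure_eq_zero_iff_ae_notMem.1 h0] with x hx
        exact ENNReal.ofReal_of_nonpos (not_lt.1 hx)
      rw [lintegral_congr_ae hz]
      simp
    simp at h1
  obtain ⟨w, hw⟩ := hne
  have hpos : 0 < f w := interior_subset (s := {x | 0 < f x}) hw
  obtain ⟨s, hs, hsub⟩ := Metric.eventually_nhds_iff_ball.1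
    ((hf.logConcave.continuousAt hw).eventually (lt_mem_nhds (half_lt_self hpos)))
  exact ⟨w, s, hs, f w / 2, by positivity, fun z hz => (hsub z hz).le⟩

/-- A log-concave density vanishes at infinity. -/
lemma IsLogConcaveDensity.tendsto_cobounded [IsProbabilityMeasure Q]
    (hf : IsLogConcaveDensity Q f) : Tendsto f (Bornology.cobounded _) (𝓝 0) := by
  obtain ⟨w, s, hs, b, hb, hw⟩ := hf.exists_ball
  rw [Metric.tendsto_nhds]
  intro ε hε
  set m : ℝ := ε ^ (1 - 1 / 2 : ℝ) * b ^ (1 / 2 : ℝ) with hm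
  have hm0 : 0 < m := by positivity
  set v := ENNReal.ofReal m * volume (ball (0 : EuclideanSpace ℝ (Fin d)) (1 / 2 * s)) with hv
  have hv0 : v ≠ 0 := by
    refine mul_ne_zero (by simpa using hm0) (measure_ball_pos _ _ (by positivity)).ne'
  have htight : Tendsto (fun n : ℕ => Q (closedBall 0 n)ᶜ) atTop (𝓝 0) := by
    have h := tendsto_measure_iInter_atTop (μ := Q)
      (s := fun n : ℕ => (closedBall (0 : EuclideanSpace ℝ (Fin d)) n)ᶜ)
      (fun n => isClosed_closedBall.measurableSet.compl.nullMeasurableSet)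
      (fun m n hmn => compl_subset_compl.2 (closedBall_subset_closedBall (by exact_mod_cast hmn)))
      ⟨0, measure_ne_top _ _⟩
    rwa [← compl_iUnion, iUnion_closedBall_nat, compl_univ, measure_empty] at h
  obtain ⟨N, hN⟩ := (htight.eventually (gt_mem_nhds (pos_iff_ne_zero.2 hv0))).exists
  have hfar : ∀ᶠ y in Bornology.cobounded (EuclideanSpace ℝ (Fin d)),
      2 * N + ‖w‖ + s ≤ ‖y‖ := tendsto_norm_cobounded_atTop.eventually_ge_atTop _
  filter_upwards [hfar] with y hy
  rw [Real.dist_0_eq_abs, abs_of_nonneg (hf.logConcave.nonneg y)]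
  by_contra! hεy
  have hball := hf.logConcave.rpow_mul_rpow_le_on_ball hb.le hε.le hw hεy
    (t := 1 / 2) (by norm_num) (by norm_num)
  have h1 := hf.mul_volume_le isOpen_ball.measurableSet hball
  rw [Measure.addHaar_ball_center] at h1
  refine absurd (h1.trans (measure_mono ?_)) (not_le.2 hN)
  intro p hp
  rw [mem_compl_iff, mem_closedBall, dist_zero_right, not_le]
  rw [mem_ball, dist_eq_norm] at hp
  have e1 : ‖((1 - 1 / 2 : ℝ)) • y‖ = 1 / 2 * ‖y‖ := by
    rw [norm_smul]; norm_num
  have e2 : ‖((1 / 2 : ℝ)) • w‖ = 1 / 2 * ‖w‖ := by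
    rw [norm_smul]; norm_num
  have e3 : ‖((1 - 1 / 2 : ℝ)) • y‖ ≤
      ‖p‖ + ‖p - ((1 - 1 / 2 : ℝ) • y + (1 / 2 : ℝ) • w)‖ + ‖((1 / 2 : ℝ)) • w‖ := by
    calc ‖((1 - 1 / 2 : ℝ)) • y‖
        = ‖(p - (p - ((1 - 1 / 2 : ℝ) • y + (1 / 2 : ℝ) • w))) - (1 / 2 : ℝ) • w‖ := by
          congr 1; abel
      _ ≤ _ := (norm_sub_le _ _).trans (add_le_add_left (norm_sub_le _ _) _)
  linarith

end Density

section WeakLimit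

variable {d : ℕ} {P : ProbabilityMeasure (EuclideanSpace ℝ (Fin d))}
  {Pn : ℕ → ProbabilityMeasure (EuclideanSpace ℝ (Fin d))}
  {f : EuclideanSpace ℝ (Fin d) → ℝ} {fn : ℕ → EuclideanSpace ℝ (Fin d) → ℝ}

lemma tendsto_measure_ball (hf : IsLogConcaveDensity (P : Measure (EuclideanSpace ℝ (Fin d))) f)
    (hweak : Tendsto Pn atTop (𝓝 P)) (x : EuclideanSpace ℝ (Fin d)) (r : ℝ) :
    Tendsto (fun n => (Pn n : Measure (EuclideanSpace ℝ (Fin d))) (ball x r)) atTop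
      (𝓝 ((P : Measure (EuclideanSpace ℝ (Fin d))) (ball x r))) := by
  refine ProbabilityMeasure.tendsto_measure_of_null_frontier_of_tendsto' hweak ?_
  rw [hf.density]
  exact withDensity_absolutelyContinuous _ _ ((convex_ball x r).addHaar_frontier volume)

lemma exists_finite_net (x₀ : EuclideanSpace ℝ (Fin d)) (r : ℝ) {δ : ℝ} (hδ : 0 < δ) :
    ∃ T : Set (EuclideanSpace ℝ (Fin d)), T ⊆ ball x₀ r ∧ T.Finite ∧
      ∀ x ∈ ball x₀ r, ∃ y ∈ T, dist x y < δ := by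
  obtain ⟨T, h1, h2, h3⟩ := finite_approx_of_totallyBounded
    ((isCompact_closedBall x₀ r).totallyBounded.subset ball_subset_closedBall) δ hδ
  exact ⟨T, h1, h2, fun x hx => by simpa using h3 hx⟩

lemma ofReal_mul_volume_ball_lt {a b : ℝ} (hb : 0 < b) (hab : a < b)
    (x : EuclideanSpace ℝ (Fin d)) {r : ℝ} (hr : 0 < r) :
    ENNReal.ofReal a * volume (ball x r) < ENNReal.ofReal b * volume (ball x r) :=
  ENNReal.mul_lt_mul_left (measure_ball_pos _ _ hr).ne' measure_ball_lt_top.ne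
    ((ENNReal.ofReal_lt_ofReal_iff hb).2 hab)

lemma eventually_ge_on_ball
    (hf : IsLogConcaveDensity (P : Measure (EuclideanSpace ℝ (Fin d))) f)
    (hfn : ∀ n, IsLogConcaveDensity (Pn n : Measure (EuclideanSpace ℝ (Fin d))) (fn n))
    (hweak : Tendsto Pn atTop (𝓝 P)) {x₀ : EuclideanSpace ℝ (Fin d)} {r c c' : ℝ}
    (hcc : c < c') (h : ∀ x ∈ ball x₀ r, c' ≤ f x) :
    ∀ᶠ n in atTop, ∀ x ∈ ball x₀ (r / 2), c ≤ fn n x := by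
  rcases le_or_gt c 0 with hc | hc
  · exact Eventually.of_forall fun n x _ => hc.trans ((hfn n).logConcave.nonneg x)
  rcases le_or_gt r 0 with hr | hr
  · rw [ball_eq_empty.2 (by linarith)]
    simp
  obtain ⟨T, hT, hfin, hnet⟩ := exists_finite_net x₀ (3 * r / 4) (δ := r / 8) (by positivity)
  have hev : ∀ᶠ n in atTop, ∀ y ∈ T, ∃ z ∈ ball y (r / 8), c ≤ fn n z := by
    refine (Filter.eventually_all_finite hfin).2 fun y hy => ?_
    have hyr : ball y (r / 8) ⊆ ball x₀ r := by
      refine ball_subset_ball' ?_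
      have := mem_ball.1 (hT hy)
      linarith
    have hlt := (ofReal_mul_volume_ball_lt (hc.trans hcc) hcc y
      (show 0 < r / 8 by positivity)).trans_le
      (hf.mul_volume_le isOpen_ball.measurableSet fun x hx => h x (hyr hx))
    filter_upwards [(tendsto_measure_ball hf hweak y (r / 8)).eventually (lt_mem_nhds hlt)]
      with n hn
    by_contra! hcon
    exact absurd ((hfn n).le_mul_volume isOpen_ball.measurableSet fun x hx => (hcon x hx).le)
      (not_le.2 hn)
  filter_upwards [hev] with n hn
  refine ((hfn n).logConcave.convex_ge c).ball_subset_of_dense (ε := r / 4) (by positivity) ?_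
  intro x hx
  obtain ⟨y, hyT, hxy⟩ := hnet x (by rwa [show 3 * r / 4 = r / 2 + r / 4 by ring])
  obtain ⟨z, hz, hcz⟩ := hn y hyT
  refine ⟨z, hcz, (dist_triangle x y z).trans ?_⟩
  have := mem_ball'.1 hz
  linarith

lemma exists_ball_eventually_ge
    (hf : IsLogConcaveDensity (P : Measure (EuclideanSpace ℝ (Fin d))) f)
    (hfn : ∀ n, IsLogConcaveDensity (Pn n : Measure (EuclideanSpace ℝ (Fin d))) (fn n))
    (hweak : Tendsto Pn atTop (𝓝 P)) :
    ∃ w : EuclideanSpace ℝ (Fin d), ∃ s > 0, ∃ b > 0,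
      ∀ᶠ n in atTop, ∀ z ∈ ball w s, b ≤ fn n z := by
  obtain ⟨w, s, hs, b, hb, h⟩ := hf.exists_ball
  exact ⟨w, s / 2, by positivity, b / 2, by positivity,
    eventually_ge_on_ball hf hfn hweak (half_lt_self hb) h⟩

lemma eventually_le_on_ball
    (hf : IsLogConcaveDensity (P : Measure (EuclideanSpace ℝ (Fin d))) f)
    (hfn : ∀ n, IsLogConcaveDensity (Pn n : Measure (EuclideanSpace ℝ (Fin d))) (fn n))
    (hweak : Tendsto Pn atTop (𝓝 P)) {x₀ : EuclideanSpace ℝ (Fin d)} {r c c' : ℝ}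
    (hcc : c' < c) (h : ∀ x ∈ ball x₀ r, f x ≤ c') :
    ∀ᶠ n in atTop, ∀ x ∈ ball x₀ (r / 2), fn n x ≤ c := by
  rcases le_or_gt r 0 with hr | hr
  · rw [ball_eq_empty.2 (by linarith)]
    simp
  have hc' : 0 ≤ c' := (hf.logConcave.nonneg x₀).trans (h x₀ (mem_ball_self hr))
  have hc : 0 < c := hc'.trans_lt hcc
  obtain ⟨w, s, hs, b, hb, hw⟩ := exists_ball_eventually_ge hf hfn hweak
  obtain ⟨m, hm1, hm2⟩ := exists_between hcc
  obtain ⟨t, ht0, ht1, htm, htr⟩ : ∃ t : ℝ, 0 < t ∧ t < 1 ∧ m < c ^ (1 - t) * b ^ t ∧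
      t * (dist w x₀ + r + s) < r / 4 := by
    have h1 : Tendsto (fun t : ℝ => c ^ (1 - t) * b ^ t) (𝓝 0) (𝓝 c) := by
      have : Continuous fun t : ℝ => c ^ (1 - t) * b ^ t := by
        refine Continuous.mul ?_ ?_
        · exact continuous_const.rpow (by fun_prop) fun t => Or.inl hc.ne'
        · exact continuous_const.rpow (by fun_prop) fun t => Or.inl hb.ne'
      simpa using this.tendsto 0
    have h2 : Tendsto (fun t : ℝ => t * (dist w x₀ + r + s)) (𝓝 0) (𝓝 0) := by
      have : Continuous fun t : ℝ => t * (dist w x₀ + r + s) := by fun_prop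
      simpa using this.tendsto 0
    have h3 : ∀ᶠ t : ℝ in 𝓝[>] 0, 0 < t := self_mem_nhdsWithin
    have h4 : ∀ᶠ t : ℝ in 𝓝[>] 0, t < 1 := nhdsWithin_le_nhds (gt_mem_nhds one_pos)
    have h5 : ∀ᶠ t : ℝ in 𝓝[>] 0, m < c ^ (1 - t) * b ^ t :=
      nhdsWithin_le_nhds (h1.eventually (lt_mem_nhds hm2))
    have h6 : ∀ᶠ t : ℝ in 𝓝[>] 0, t * (dist w x₀ + r + s) < r / 4 :=
      nhdsWithin_le_nhds (h2.eventually (gt_mem_nhds (by positivity)))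
    exact (h3.and (h4.and (h5.and h6))).exists
  have hts : 0 < t * s / 2 := by positivity
  have htsr : t * s < r / 4 := by
    have : 0 ≤ t * (dist w x₀ + r) := by positivity
    linarith
  obtain ⟨T, hT, hfin, hnet⟩ := exists_finite_net x₀ (3 * r / 4) hts
  have hev : ∀ᶠ n in atTop, ∀ y ∈ T, (Pn n : Measure (EuclideanSpace ℝ (Fin d)))
      (ball y (t * s / 2)) < ENNReal.ofReal m * volume (ball y (t * s / 2)) := by
    refine (Filter.eventually_all_finite hfin).2 fun y hy => ?_
    have hyr : ball y (t * s / 2) ⊆ ball x₀ r := by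
      refine ball_subset_ball' ?_
      have := mem_ball.1 (hT hy)
      linarith
    exact (tendsto_measure_ball hf hweak y (t * s / 2)).eventually (gt_mem_nhds
      ((hf.le_mul_volume isOpen_ball.measurableSet fun x hx => h x (hyr hx)).trans_lt
        (ofReal_mul_volume_ball_lt (hc'.trans_lt hm1) hm1 y hts)))
  filter_upwards [hev, hw] with n hn hwn x hx
  by_contra! hcx
  have hball := (hfn n).logConcave.rpow_mul_rpow_le_on_ball hb.le hc.le hwn hcx.le ht0 ht1
  have hx' : (1 - t) • x + t • w ∈ ball x₀ (3 * r / 4) := by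
    rw [mem_ball] at hx ⊢
    have e : dist ((1 - t) • x + t • w) x = t * dist w x := by
      rw [dist_eq_norm, dist_eq_norm,
        show (1 - t) • x + t • w - x = t • (w - x) by rw [sub_smul, one_smul, smul_sub]; abel,
        norm_smul, Real.norm_eq_abs, abs_of_pos ht0]
    have e2 : t * dist w x ≤ t * (dist w x₀ + r + s) := by
      have := dist_triangle_right w x x₀
      gcongr
      linarith
    have := dist_triangle ((1 - t) • x + t • w) x x₀
    linarith
  obtain ⟨y, hyT, hy⟩ := hnet _ hx'
  have hsub : ball y (t * s / 2) ⊆ ball ((1 - t) • x + t • w) (t * s) := by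
    refine ball_subset_ball' ?_
    rw [dist_comm]
    linarith
  exact absurd ((hfn n).mul_volume_le isOpen_ball.measurableSet
    fun p hp => htm.le.trans (hball p (hsub hp))) (not_le.2 (hn y hyT))

lemma exists_eventually_le
    (hf : IsLogConcaveDensity (P : Measure (EuclideanSpace ℝ (Fin d))) f)
    (hfn : ∀ n, IsLogConcaveDensity (Pn n : Measure (EuclideanSpace ℝ (Fin d))) (fn n))
    (hweak : Tendsto Pn atTop (𝓝 P)) : ∃ M : ℝ, ∀ᶠ n in atTop, ∀ x, fn n x ≤ M := by
  obtain ⟨w, s, hs, b, hb, hw⟩ := exists_ball_eventually_ge hf hfn hweak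
  set V := volume.real (ball (0 : EuclideanSpace ℝ (Fin d)) (1 / 2 * s)) with hV
  have hV0 : 0 < V := by
    rw [hV, measureReal_def]
    exact ENNReal.toReal_pos (measure_ball_pos _ _ (by positivity)).ne' measure_ball_lt_top.ne
  refine ⟨(1 / V) ^ 2 / b, ?_⟩
  filter_upwards [hw] with n hn x
  have h0 := (hfn n).logConcave.nonneg x
  have hball := (hfn n).logConcave.rpow_mul_rpow_le_on_ball hb.le h0 hn le_rfl
    (t := 1 / 2) (by norm_num) (by norm_num)
  have h1 := ((hfn n).mul_volume_le isOpen_ball.measurableSet hball).trans prob_le_one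
  rw [Measure.addHaar_ball_center] at h1
  have h2 := ENNReal.toReal_mono ENNReal.one_ne_top h1
  rw [ENNReal.toReal_mul, ENNReal.toReal_ofReal (by positivity), ← measureReal_def, ← hV,
    ENNReal.toReal_one, show (1 - 1 / 2 : ℝ) = 1 / 2 by norm_num, ← Real.sqrt_eq_rpow,
    ← Real.sqrt_eq_rpow, ← le_div_iff₀ hV0] at h2
  have h3 := pow_le_pow_left₀ (by positivity) h2 2
  rw [mul_pow, Real.sq_sqrt h0, Real.sq_sqrt hb.le] at h3
  rwa [le_div_iff₀ hb]

end WeakLimit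

section Sublinear

variable {E : Type*}

lemma IsSublinear.convexOn [AddCommGroup E] [Module ℝ E] {A : E → ℝ} (hA : IsSublinear A) :
    ConvexOn ℝ univ A :=
  ⟨convex_univ, fun x _ y _ a b ha hb _ => by
    rw [smul_eq_mul, smul_eq_mul, ← hA.smul_eq a x ha, ← hA.smul_eq b y hb]
    exact hA.add_le _ _⟩

lemma IsSublinear.continuous [NormedAddCommGroup E] [NormedSpace ℝ E] [FiniteDimensional ℝ E]
    {A : E → ℝ} (hA : IsSublinear A) : Continuous A :=
  continuousOn_univ.1 (hA.convexOn.continuousOn isOpen_univ)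

end Sublinear

lemma integrable_exp_neg_mul_norm {E : Type*} [NormedAddCommGroup E] [NormedSpace ℝ E]
    [FiniteDimensional ℝ E] [MeasurableSpace E] [BorelSpace E] (μ : Measure E)
    [μ.IsAddHaarMeasure] {a : ℝ} (ha : 0 < a) : Integrable (fun x => Real.exp (-a * ‖x‖)) μ := by
  set n := Module.finrank ℝ E + 1 with hn
  have hint := (integrable_one_add_norm (E := E) (μ := μ) (r := (n : ℝ))
    (by rw [hn]; push_cast; linarith)).const_mul (Real.exp a * n.factorial / a ^ n)
  refine hint.mono' (by fun_prop) (Eventually.of_forall fun x => ?_)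
  have h := Real.pow_div_factorial_le_exp (a * (1 + ‖x‖)) (by positivity) n
  rw [Real.norm_eq_abs, abs_of_pos (Real.exp_pos _), Real.rpow_neg (by positivity),
    Real.rpow_natCast]
  rw [mul_add, mul_one, Real.exp_add, ← mul_one_add, mul_pow] at h
  rw [neg_mul, Real.exp_neg, inv_le_iff_one_le_mul₀ (Real.exp_pos _)]
  have hpos : 0 < a ^ n * (1 + ‖x‖) ^ n / n.factorial := by positivity
  calc (1 : ℝ) ≤ (Real.exp a * Real.exp (a * ‖x‖)) / (a ^ n * (1 + ‖x‖) ^ n / n.factorial) :=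
        (one_le_div hpos).2 h
    _ = _ := by field_simp

/-- Log-concavity along a ray: a bound at an intermediate point propagates geometrically. -/
lemma IsLogConcave.le_mul_exp_of_le {E : Type*} [AddCommGroup E] [Module ℝ E] {f : E → ℝ}
    (hf : IsLogConcave f) {w y : E} {t q : ℝ} (h0 : 0 < t) (h1 : t < 1) (hw : 0 < f w)
    (h : f ((1 - t) • w + t • y) ≤ f w * Real.exp (t * q)) : f y ≤ f w * Real.exp q := by
  have hle := (hf.rpow_mul_rpow_le w y h0 h1).trans h
  have hF : f w = f w ^ (1 - t) * f w ^ t := by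
    rw [← Real.rpow_add hw, sub_add_cancel, Real.rpow_one]
  rw [← Real.rpow_le_rpow_iff (hf.nonneg y) (by positivity) h0,
    Real.mul_rpow hw.le (Real.exp_pos _).le, ← Real.exp_mul, mul_comm q t]
  refine le_of_mul_le_mul_left ?_ (Real.rpow_pos_of_pos hw (1 - t))
  rwa [← mul_assoc, ← hF]

section WeakLimit

variable {d : ℕ} {P : ProbabilityMeasure (EuclideanSpace ℝ (Fin d))}
  {Pn : ℕ → ProbabilityMeasure (EuclideanSpace ℝ (Fin d))}
  {f : EuclideanSpace ℝ (Fin d) → ℝ} {fn : ℕ → EuclideanSpace ℝ (Fin d) → ℝ}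
  {A : EuclideanSpace ℝ (Fin d) → ℝ}

lemma exists_sphere_eventually_le
    (hf : IsLogConcaveDensity (P : Measure (EuclideanSpace ℝ (Fin d))) f)
    (hfn : ∀ n, IsLogConcaveDensity (Pn n : Measure (EuclideanSpace ℝ (Fin d))) (fn n))
    (hweak : Tendsto Pn atTop (𝓝 P)) (hA : IsSublinear A)
    (h0 : Tendsto (fun x => f x * Real.exp (A x)) (Bornology.cobounded _) (𝓝 0))
    (w : EuclideanSpace ℝ (Fin d)) {b : ℝ} (hb : 0 < b) :
    ∃ R > 0, ∀ᶠ n in atTop, ∀ x ∈ sphere w R,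
      fn n x ≤ b * Real.exp (-Real.log 2 - A (x - w)) := by
  have hev := h0.eventually (gt_mem_nhds (show 0 < b / 8 * Real.exp (-A (-w)) by positivity))
  obtain ⟨R₁, -, hR₁⟩ := hasBasis_cobounded_norm.eventually_iff.1 hev
  refine ⟨|R₁| + ‖w‖ + 2, by positivity, ?_⟩
  set h : EuclideanSpace ℝ (Fin d) → ℝ := fun x => b * Real.exp (-A (x - w)) with hh
  have hcont : Continuous h := by
    have := hA.continuous
    fun_prop
  have hpos : ∀ x, 0 < h x := fun x => by positivity
  have hbound : ∀ x, |R₁| ≤ ‖x‖ → f x ≤ h x / 8 := by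
    intro x hx
    have h1 := hR₁ (show x ∈ {x | R₁ ≤ ‖x‖} from (le_abs_self _).trans hx)
    have h2 := hA.add_le x (-w)
    rw [← sub_eq_add_neg] at h2
    rw [← lt_div_iff₀ (Real.exp_pos _), mul_div_assoc, ← Real.exp_sub] at h1
    refine h1.le.trans ?_
    calc b / 8 * Real.exp (-A (-w) - A x) ≤ b / 8 * Real.exp (-A (x - w)) := by
          gcongr
          linarith
      _ = h x / 8 := by simp only [hh]; ring
  refine (isCompact_sphere w _).eventually_forall_of_nhds fun x₀ hx₀ => ?_
  have hx₀pos := hpos x₀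
  obtain ⟨r, hr, hball⟩ := Metric.eventually_nhds_iff_ball.1
    ((hcont.continuousAt.eventually (gt_mem_nhds (show h x₀ < 2 * h x₀ by linarith))).and
      ((hcont.continuousAt.eventually (lt_mem_nhds (show 3 / 4 * h x₀ < h x₀ by linarith))).and
        (Metric.ball_mem_nhds x₀ one_pos)))
  have hle := eventually_le_on_ball hf hfn hweak (x₀ := x₀) (r := r) (c' := h x₀ / 4)
    (c := 3 / 8 * h x₀) (by linarith) (fun x hx => by
      obtain ⟨h1, -, h3⟩ := hball x hx
      refine (hbound x ?_).trans (by linarith)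
      rw [mem_sphere, dist_eq_norm] at hx₀
      rw [dist_comm, dist_eq_norm] at h3
      have e1 := norm_sub_le x₀ w
      have e2 := norm_sub_norm_le x₀ x
      linarith)
  refine ⟨ball x₀ (r / 2), ball_mem_nhds _ (by positivity), ?_⟩
  filter_upwards [hle] with n hn x hx
  obtain ⟨-, h2, -⟩ := hball x (ball_subset_ball (by linarith) hx)
  have e : b * Real.exp (-Real.log 2 - A (x - w)) = h x / 2 := by
    rw [sub_eq_add_neg, Real.exp_add, Real.exp_neg, Real.exp_log two_pos]
    simp only [hh]
    ring
  rw [e]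
  linarith [hn x hx]

lemma exists_eventually_exp_mul_le
    (hf : IsLogConcaveDensity (P : Measure (EuclideanSpace ℝ (Fin d))) f)
    (hfn : ∀ n, IsLogConcaveDensity (Pn n : Measure (EuclideanSpace ℝ (Fin d))) (fn n))
    (hweak : Tendsto Pn atTop (𝓝 P)) (hA : IsSublinear A)
    (h0 : Tendsto (fun x => f x * Real.exp (A x)) (Bornology.cobounded _) (𝓝 0)) :
    ∃ C : ℝ, ∃ a > 0, ∀ᶠ n in atTop, ∀ y,
      Real.exp (A y) * fn n y ≤ C * Real.exp (-a * ‖y‖) := by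
  obtain ⟨w, s, hs, b, hb, hw⟩ := exists_ball_eventually_ge hf hfn hweak
  obtain ⟨M, hM⟩ := exists_eventually_le hf hfn hweak
  obtain ⟨R, hR, hsph⟩ := exists_sphere_eventually_le hf hfn hweak hA h0 w hb
  set a := Real.log 2 / R with ha
  have ha0 : 0 < a := div_pos (Real.log_pos one_lt_two) hR
  obtain ⟨K, hK⟩ := (isCompact_closedBall w R).bddAbove_image
    (f := fun y => Real.exp (A y + a * ‖y‖)) (by
      have := hA.continuous
      fun_prop)
  refine ⟨max (K * M) (Real.exp (A w + a * ‖w‖) * M), a, ha0, ?_⟩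
  filter_upwards [hw, hM, hsph] with n hwn hMn hsn y
  have hbw : b ≤ fn n w := hwn w (mem_ball_self hs)
  have hM0 : 0 < M := hb.trans_le (hbw.trans (hMn w))
  rw [neg_mul, Real.exp_neg, ← div_eq_mul_inv, le_div_iff₀ (Real.exp_pos _)]
  rcases le_or_gt (dist y w) R with hy | hy
  · refine le_trans ?_ (le_max_left _ _)
    calc Real.exp (A y) * fn n y * Real.exp (a * ‖y‖)
        = Real.exp (A y + a * ‖y‖) * fn n y := by rw [Real.exp_add]; ring
      _ ≤ K * M := by
        have hKy := hK (mem_image_of_mem _ (mem_closedBall.2 hy))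
        have := (hfn n).logConcave.nonneg y
        exact mul_le_mul hKy (hMn y) this ((Real.exp_pos _).le.trans hKy)
  · refine le_trans ?_ (le_max_right _ _)
    have hρ : 0 < dist y w := hR.trans hy
    have ht0 : 0 < R / dist y w := by positivity
    have hx : (1 - R / dist y w) • w + (R / dist y w) • y - w = (R / dist y w) • (y - w) := by
      rw [sub_smul, one_smul, smul_sub]; abel
    have hxs : (1 - R / dist y w) • w + (R / dist y w) • y ∈ sphere w R := by
      rw [mem_sphere, dist_eq_norm, hx, norm_smul, Real.norm_eq_abs, abs_of_pos ht0,
        ← dist_eq_norm, div_mul_cancel₀ _ hρ.ne']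
    have h1 := hsn _ hxs
    rw [hx, hA.smul_eq _ _ ht0.le] at h1
    have h2 := (hfn n).logConcave.le_mul_exp_of_le (q := -(a * dist y w) - A (y - w)) ht0
      ((div_lt_one hρ).2 hy) (hb.trans_le hbw) (by
        refine h1.trans ?_
        have e : -Real.log 2 - R / dist y w * A (y - w) =
            R / dist y w * (-(a * dist y w) - A (y - w)) := by
          rw [ha]; field_simp
        rw [e]
        gcongr)
    have h3 : A y ≤ A w + A (y - w) := by
      simpa using hA.add_le w (y - w)
    have h4 : ‖y‖ ≤ ‖w‖ + dist y w := by
      rw [dist_eq_norm]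
      exact norm_le_norm_add_norm_sub' y w
    calc Real.exp (A y) * fn n y * Real.exp (a * ‖y‖)
        ≤ Real.exp (A y) * (M * Real.exp (-(a * dist y w) - A (y - w))) *
          Real.exp (a * ‖y‖) := by
          gcongr
          refine h2.trans ?_
          gcongr
          exact hMn w
      _ = Real.exp (A y + (-(a * dist y w) - A (y - w)) + a * ‖y‖) * M := by
          rw [Real.exp_add, Real.exp_add]; ring
      _ ≤ _ := by
          refine mul_le_mul_of_nonneg_right (Real.exp_le_exp.2 ?_) hM0.le
          have := mul_le_mul_of_nonneg_left h4 ha0.le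
          linarith

lemma exists_exp_mul_le
    (hf : IsLogConcaveDensity (P : Measure (EuclideanSpace ℝ (Fin d))) f) (hA : IsSublinear A)
    (h0 : Tendsto (fun x => f x * Real.exp (A x)) (Bornology.cobounded _) (𝓝 0)) :
    ∃ C : ℝ, ∃ a > 0, ∀ y, Real.exp (A y) * f y ≤ C * Real.exp (-a * ‖y‖) := by
  obtain ⟨C, a, ha, h⟩ := exists_eventually_exp_mul_le (Pn := fun _ => P) (fn := fun _ => f) hf
    (fun _ => hf) tendsto_const_nhds hA h0
  exact ⟨C, a, ha, h.exists.choose_spec⟩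

lemma exists_nhds_eventually_abs_sub_lt
    (hf : IsLogConcaveDensity (P : Measure (EuclideanSpace ℝ (Fin d))) f)
    (hfn : ∀ n, IsLogConcaveDensity (Pn n : Measure (EuclideanSpace ℝ (Fin d))) (fn n))
    (hweak : Tendsto Pn atTop (𝓝 P)) {x : EuclideanSpace ℝ (Fin d)} (hx : ContinuousAt f x)
    {ε : ℝ} (hε : 0 < ε) : ∃ U ∈ 𝓝 x, ∀ᶠ n in atTop, ∀ y ∈ U, |fn n y - f y| < ε := by
  obtain ⟨r, hr, hball⟩ := Metric.eventually_nhds_iff_ball.1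
    (Metric.tendsto_nhds.1 hx (ε / 4) (by positivity))
  simp only [Real.dist_eq, abs_lt] at hball
  refine ⟨ball x (r / 2), ball_mem_nhds _ (by positivity), ?_⟩
  filter_upwards [eventually_ge_on_ball hf hfn hweak (x₀ := x) (r := r) (c' := f x - ε / 4)
    (c := f x - ε / 2) (by linarith) (fun y hy => by linarith [(hball y hy).1]),
    eventually_le_on_ball hf hfn hweak (x₀ := x) (r := r) (c' := f x + ε / 4)
    (c := f x + ε / 2) (by linarith) (fun y hy => by linarith [(hball y hy).2])]
    with n h1 h2 y hy
  have h3 := hball y (ball_subset_ball (by linarith) hy)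
  rw [abs_lt]
  constructor <;> linarith [h1 y hy, h2 y hy, h3.1, h3.2]

lemma tendsto_of_continuousAt
    (hf : IsLogConcaveDensity (P : Measure (EuclideanSpace ℝ (Fin d))) f)
    (hfn : ∀ n, IsLogConcaveDensity (Pn n : Measure (EuclideanSpace ℝ (Fin d))) (fn n))
    (hweak : Tendsto Pn atTop (𝓝 P)) {x : EuclideanSpace ℝ (Fin d)} (hx : ContinuousAt f x) :
    Tendsto (fun n => fn n x) atTop (𝓝 (f x)) := by
  rw [Metric.tendsto_nhds]
  intro ε hε
  obtain ⟨U, hU, h⟩ := exists_nhds_eventually_abs_sub_lt hf hfn hweak hx hε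
  filter_upwards [h] with n hn
  exact hn x (mem_of_mem_nhds hU)

lemma isSublinear_zero : IsSublinear (fun _ : EuclideanSpace ℝ (Fin d) => (0 : ℝ)) :=
  ⟨fun _ _ => by simp, fun _ _ _ => by simp⟩

lemma IsLogConcaveDensity.tendsto_mul_exp_zero
    (hf : IsLogConcaveDensity (P : Measure (EuclideanSpace ℝ (Fin d))) f) :
    Tendsto (fun x => f x * Real.exp 0) (Bornology.cobounded _) (𝓝 0) := by
  simpa using hf.tendsto_cobounded

lemma tendstoUniformlyOn_of_continuousAt
    (hf : IsLogConcaveDensity (P : Measure (EuclideanSpace ℝ (Fin d))) f)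
    (hfn : ∀ n, IsLogConcaveDensity (Pn n : Measure (EuclideanSpace ℝ (Fin d))) (fn n))
    (hweak : Tendsto Pn atTop (𝓝 P)) {S : Set (EuclideanSpace ℝ (Fin d))} (hS : IsClosed S)
    (hcont : ∀ x ∈ S, ContinuousAt f x) : TendstoUniformlyOn fn f atTop S := by
  rw [Metric.tendstoUniformlyOn_iff]
  intro ε hε
  obtain ⟨C, a, ha, hn⟩ := exists_eventually_exp_mul_le hf hfn hweak isSublinear_zero
    hf.tendsto_mul_exp_zero
  have hlim : Tendsto (fun x : EuclideanSpace ℝ (Fin d) => C * Real.exp (-a * ‖x‖))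
      (Bornology.cobounded _) (𝓝 0) := by
    have h1 : Tendsto (fun x : EuclideanSpace ℝ (Fin d) => -a * ‖x‖) (Bornology.cobounded _)
        atBot := tendsto_norm_cobounded_atTop.const_mul_atTop_of_neg (by linarith)
    simpa using (Real.tendsto_exp_atBot.comp h1).const_mul C
  obtain ⟨R, -, hR⟩ := hasBasis_cobounded_norm.eventually_iff.1
    ((hlim.eventually (gt_mem_nhds hε)).and (hf.tendsto_cobounded.eventually (gt_mem_nhds hε)))
  have hK : IsCompact (S ∩ closedBall 0 R) := (isCompact_closedBall 0 R).inter_left hS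
  filter_upwards [hn, hK.eventually_forall_of_nhds fun x hx =>
    exists_nhds_eventually_abs_sub_lt hf hfn hweak (hcont x hx.1) hε] with n hn1 hn2 x hx
  rw [dist_comm, Real.dist_eq]
  rcases le_or_gt ‖x‖ R with hxR | hxR
  · exact hn2 x ⟨hx, by simpa using hxR⟩
  · obtain ⟨h1, h2⟩ := hR (show x ∈ {x | R ≤ ‖x‖} from hxR.le)
    have h3 := hn1 x
    rw [Real.exp_zero, one_mul] at h3
    rw [abs_lt]
    constructor <;> linarith [hf.logConcave.nonneg x, (hfn n).logConcave.nonneg x]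

lemma IsLogConcaveDensity.integrable_exp_mul
    (hf : IsLogConcaveDensity (P : Measure (EuclideanSpace ℝ (Fin d))) f) (hA : IsSublinear A)
    (h0 : Tendsto (fun x => f x * Real.exp (A x)) (Bornology.cobounded _) (𝓝 0)) :
    Integrable (fun x => Real.exp (A x) * f x) := by
  obtain ⟨C, a, ha, h⟩ := exists_exp_mul_le hf hA h0
  refine ((integrable_exp_neg_mul_norm volume ha).const_mul C).mono' ?_
    (Eventually.of_forall fun x => ?_)
  · have h1 := hA.continuous
    have h2 : AEMeasurable f := hf.logConcave.aemeasurable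
    exact ((Real.continuous_exp.comp h1).measurable.aemeasurable.mul h2).aestronglyMeasurable
  · rw [Real.norm_eq_abs, abs_of_nonneg (mul_nonneg (Real.exp_pos _).le (hf.logConcave.nonneg x))]
    exact h x

lemma tendsto_lintegral_exp_mul_abs_sub
    (hf : IsLogConcaveDensity (P : Measure (EuclideanSpace ℝ (Fin d))) f)
    (hfn : ∀ n, IsLogConcaveDensity (Pn n : Measure (EuclideanSpace ℝ (Fin d))) (fn n))
    (hweak : Tendsto Pn atTop (𝓝 P)) (hA : IsSublinear A)
    (h0 : Tendsto (fun x => f x * Real.exp (A x)) (Bornology.cobounded _) (𝓝 0)) :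
    Tendsto (fun n => ∫⁻ x, ENNReal.ofReal (Real.exp (A x) * |fn n x - f x|)) atTop (𝓝 0) := by
  obtain ⟨C, a, ha, hn⟩ := exists_eventually_exp_mul_le hf hfn hweak hA h0
  have hint := ((integrable_exp_neg_mul_norm (E := EuclideanSpace ℝ (Fin d)) volume
    ha).const_mul C).add (hf.integrable_exp_mul hA h0)
  have hAm : Measurable A := hA.continuous.measurable
  have hfm : AEMeasurable f := hf.logConcave.aemeasurable
  rw [← lintegral_zero (μ := (volume : Measure (EuclideanSpace ℝ (Fin d))))]
  refine tendsto_lintegral_filter_of_dominated_convergence' _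
    (Eventually.of_forall fun n => ?_) ?_ hint.lintegral_lt_top.ne ?_
  · have hfnm : AEMeasurable (fn n) := (hfn n).logConcave.aemeasurable
    fun_prop
  · filter_upwards [hn] with n hn1
    refine Eventually.of_forall fun x => ENNReal.ofReal_le_ofReal ?_
    have h1 : |fn n x - f x| ≤ fn n x + f x := by
      rw [abs_le]
      constructor <;> linarith [hf.logConcave.nonneg x, (hfn n).logConcave.nonneg x]
    calc Real.exp (A x) * |fn n x - f x| ≤ Real.exp (A x) * (fn n x + f x) := by gcongr
      _ = Real.exp (A x) * fn n x + Real.exp (A x) * f x := mul_add _ _ _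
      _ ≤ _ := add_le_add_left (hn1 x) _
  · filter_upwards [hf.logConcave.ae_continuousAt] with x hx
    have h1 := ((tendsto_of_continuousAt hf hfn hweak hx).sub_const (f x)).abs.const_mul
      (Real.exp (A x))
    simpa using ENNReal.tendsto_ofReal h1

lemma tendsto_lintegral_abs_sub
    (hf : IsLogConcaveDensity (P : Measure (EuclideanSpace ℝ (Fin d))) f)
    (hfn : ∀ n, IsLogConcaveDensity (Pn n : Measure (EuclideanSpace ℝ (Fin d))) (fn n))
    (hweak : Tendsto Pn atTop (𝓝 P)) :
    Tendsto (fun n => ∫⁻ x, ENNReal.ofReal |fn n x - f x|) atTop (𝓝 0) := by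
  simpa using tendsto_lintegral_exp_mul_abs_sub hf hfn hweak isSublinear_zero
    hf.tendsto_mul_exp_zero

lemma IsLogConcaveDensity.measure_le_add {Q₁ Q₂ : Measure (EuclideanSpace ℝ (Fin d))}
    {f₁ f₂ : EuclideanSpace ℝ (Fin d) → ℝ} (h₁ : IsLogConcaveDensity Q₁ f₁)
    (h₂ : IsLogConcaveDensity Q₂ f₂) {B : Set (EuclideanSpace ℝ (Fin d))}
    (hB : MeasurableSet B) : Q₁ B ≤ Q₂ B + ∫⁻ x, ENNReal.ofReal |f₁ x - f₂ x| := by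
  have m₁ : AEMeasurable f₁ := h₁.logConcave.aemeasurable
  have m₂ : AEMeasurable f₂ := h₂.logConcave.aemeasurable
  rw [h₁.apply hB, h₂.apply hB]
  calc ∫⁻ x in B, ENNReal.ofReal (f₁ x)
      ≤ ∫⁻ x in B, (ENNReal.ofReal (f₂ x) + ENNReal.ofReal |f₁ x - f₂ x|) := by
        refine lintegral_mono fun x => ?_
        refine (ENNReal.ofReal_le_ofReal ?_).trans ENNReal.ofReal_add_le
        linarith [le_abs_self (f₁ x - f₂ x)]
    _ = (∫⁻ x in B, ENNReal.ofReal (f₂ x)) + ∫⁻ x in B, ENNReal.ofReal |f₁ x - f₂ x| :=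
        lintegral_add_right' _ (m₁.sub m₂).norm.ennreal_ofReal.restrict
    _ ≤ _ := by
        gcongr
        exact Measure.restrict_le_self

lemma IsLogConcaveDensity.tvDistance_le {Q₁ Q₂ : ProbabilityMeasure (EuclideanSpace ℝ (Fin d))}
    {f₁ f₂ : EuclideanSpace ℝ (Fin d) → ℝ}
    (h₁ : IsLogConcaveDensity (Q₁ : Measure (EuclideanSpace ℝ (Fin d))) f₁)
    (h₂ : IsLogConcaveDensity (Q₂ : Measure (EuclideanSpace ℝ (Fin d))) f₂)
    (hfin : ∫⁻ x, ENNReal.ofReal |f₁ x - f₂ x| ≠ ⊤) :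
    tvDistance Q₁ Q₂ ≤ (∫⁻ x, ENNReal.ofReal |f₁ x - f₂ x|).toReal := by
  refine Real.iSup_le (fun B => ?_) ENNReal.toReal_nonneg
  have e₁ := ENNReal.toReal_mono (by finiteness) (h₁.measure_le_add h₂ B.2)
  have e₂ := h₂.measure_le_add h₁ B.2
  simp only [abs_sub_comm (f₂ _)] at e₂
  replace e₂ := ENNReal.toReal_mono (by finiteness) e₂
  rw [ENNReal.toReal_add (by finiteness) hfin] at e₁ e₂
  rw [abs_sub_le_iff, measureReal_def, measureReal_def]
  constructor <;> linarith

lemma tendsto_tvDistance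
    (hf : IsLogConcaveDensity (P : Measure (EuclideanSpace ℝ (Fin d))) f)
    (hfn : ∀ n, IsLogConcaveDensity (Pn n : Measure (EuclideanSpace ℝ (Fin d))) (fn n))
    (hweak : Tendsto Pn atTop (𝓝 P)) : Tendsto (fun n => tvDistance (Pn n) P) atTop (𝓝 0) := by
  have h := tendsto_lintegral_abs_sub hf hfn hweak
  have hr := (ENNReal.tendsto_toReal ENNReal.zero_ne_top).comp h
  refine squeeze_zero' (Eventually.of_forall fun n => Real.iSup_nonneg fun B => abs_nonneg _) ?_ hr
  filter_upwards [h.eventually (gt_mem_nhds ENNReal.zero_lt_top)] with n hn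
  exact (hfn n).tvDistance_le hf hn.ne

end WeakLimit

end

theorem mainTheorem1 (d : ℕ)
    (P : ProbabilityMeasure (EuclideanSpace ℝ (Fin d)))
    (Pn : ℕ → ProbabilityMeasure (EuclideanSpace ℝ (Fin d)))
    (f : EuclideanSpace ℝ (Fin d) → ℝ)
    (fn : ℕ → EuclideanSpace ℝ (Fin d) → ℝ)
    (hf : IsLogConcaveDensity (P : Measure (EuclideanSpace ℝ (Fin d))) f)
    (hfn : ∀ n, IsLogConcaveDensity (Pn n : Measure (EuclideanSpace ℝ (Fin d))) (fn n))
    (hweak : Tendsto Pn atTop (𝓝 P)) :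
    -- (i) uniform convergence on closed sets of continuity points, and convergence a.e.
    ((∀ S : Set (EuclideanSpace ℝ (Fin d)), IsClosed S → (∀ x ∈ S, ContinuousAt f x) →
        TendstoUniformlyOn fn f atTop S) ∧
      (∀ᵐ x, Tendsto (fun n => fn n x) atTop (𝓝 (f x)))) ∧
    -- (ii) exponentially weighted convergence, and convergence in total variation
    ((∀ A : EuclideanSpace ℝ (Fin d) → ℝ, IsSublinear A →
        Tendsto (fun x => f x * Real.exp (A x))
          (comap (fun x : EuclideanSpace ℝ (Fin d) => ‖x‖) atTop) (𝓝 0) →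
        Integrable (fun x => Real.exp (A x) * f x) ∧
        Tendsto (fun n => ∫⁻ x, ENNReal.ofReal (Real.exp (A x) * |fn n x - f x|)) atTop (𝓝 0)) ∧
      (Tendsto (fun n => ∫⁻ x, ENNReal.ofReal |fn n x - f x|) atTop (𝓝 0)) ∧
      (Tendsto (fun n => tvDistance (Pn n) P) atTop (𝓝 0))) := by
  simp only [comap_norm_atTop]
  exact ⟨⟨fun S hS hcont => tendstoUniformlyOn_of_continuousAt hf hfn hweak hS hcont,
      hf.logConcave.ae_continuousAt.mono fun x hx => tendsto_of_continuousAt hf hfn hweak hx⟩,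
    fun A hA h0 => ⟨hf.integrable_exp_mul hA h0,
      tendsto_lintegral_exp_mul_abs_sub hf hfn hweak hA h0⟩,
    tendsto_lintegral_abs_sub hf hfn hweak, tendsto_tvDistance hf hfn hweak⟩
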